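/- Let $0<\alpha\le 1$, let $\boldsymbol\pi=(\pi_1,\dots,\pi_p)$ be a probability (row) vector, let $\boldsymbol T$ be a $p\times p$ sub-intensity matrix all of whose states are transient (nonnegative off-diagonal entries, $\boldsymbol t:=-\boldsymbol T\boldsymbol e\ge 0$ with $\boldsymbol e=(1,\dots,1)^{\prime}$, and absorption can be reached from every state), and let $\boldsymbol R$ be a $p\times n$ matrix with nonnegative entries. For a vector $\boldsymbol v$, $\boldsymbol\Delta(\boldsymbol v)$ denotes the diagonal matrix with diagonal $\boldsymbol v$, and powers of vectors are taken entrywise. A random vector $\boldsymbol Y$ with values in $[0,\infty)^n$ is $\mathrm{MPH}^*_\alpha(\boldsymbol\pi,\boldsymbol T,\boldsymbol R)$ distributed if its joint Laplace transform is $$\mathbb E\, e^{-\langle \boldsymbol Y,\boldsymbol\theta\rangle}=\boldsymbol\pi\left(\boldsymbol\Delta((\boldsymbol R\boldsymbol\theta)^\alpha)-\boldsymbol T\right)^{-1}\boldsymbol t,\qquad \boldsymbol\theta\in[0,\infty)^n .$$ For a nonnegative vector $\boldsymbol\beta$ with $\boldsymbol\beta\boldsymbol e\le 1$ and a sub-intensity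 matrix $\boldsymbol S$ with transient states, $\mathrm{PH}_\alpha(\boldsymbol\beta,\boldsymbol S)$ is the (possibly defective) distribution on $[0,\infty)$, of total mass $\boldsymbol\beta\boldsymbol e$, with Laplace transform $u\mapsto \boldsymbol\beta(u^\alpha \boldsymbol I-\boldsymbol S)^{-1}(-\boldsymbol S\boldsymbol e)$, $u\ge 0$. **Theorem.** Let $\boldsymbol Y\sim \mathrm{MPH}^*_\alpha(\boldsymbol\pi,\boldsymbol T,\boldsymbol R)$ and let $\boldsymbol w\ge \boldsymbol 0$ be a non-zero vector in $\mathbb R^n$. Let $E_+$ and $E_0$ be the sets of those $i\in\{1,\dots,p\}$ for which $(\boldsymbol R\boldsymbol w)_i>0$ and $(\boldsymbol R\boldsymbol w)_i=0$ respectively, and decompose accordingly $$\boldsymbol\pi=(\boldsymbol\pi_+,\boldsymbol\pi_0),\qquad \boldsymbol T=\begin{pmatrix}\boldsymbol T_{++}&\boldsymbol T_{+0}\\ \boldsymbol T_{0+}&\boldsymbol T_{00}\end{pmatrix}.$$ Then $\boldsymbol T_{00}$ is invertible, and with $$\boldsymbol\pi_{\boldsymbol w}=\boldsymbol\pi_++\boldsymbol\pi_0(-\boldsymbol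 T_{00})^{-1}\boldsymbol T_{0+},\qquad \boldsymbol T_{\boldsymbol w}=\boldsymbol\Delta\left((\boldsymbol R\boldsymbol w)_+^\alpha\right)^{-1}\left(\boldsymbol T_{++}+\boldsymbol T_{+0}(-\boldsymbol T_{00})^{-1}\boldsymbol T_{0+}\right)$$ the vector $\boldsymbol\pi_{\boldsymbol w}$ is nonnegative with $\boldsymbol\pi_{\boldsymbol w}\boldsymbol e\le 1$, $\boldsymbol T_{\boldsymbol w}$ is a sub-intensity matrix with transient states, and the law of $\langle \boldsymbol Y,\boldsymbol w\rangle$ is the sum of an absolutely continuous part (with respect to Lebesgue measure), which is $\mathrm{PH}_\alpha(\boldsymbol\pi_{\boldsymbol w},\boldsymbol T_{\boldsymbol w})$, and an atom at zero of size $1-\boldsymbol\pi_{\boldsymbol w}\boldsymbol e$. (If $E_+=\emptyset$, the absolutely continuous part is zero.) -/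

import Mathlib

open MeasureTheory
open scoped Matrix

noncomputable section

/-- The column vector `t = -T e` of absorption rates belonging to the matrix `T` of jump rates
between the transient states. -/
def exitRates {ι : Type*} [Fintype ι] (T : Matrix ι ι ℝ) : ι → ℝ :=
  -(T *ᵥ 1)

/-- `T` is a sub-intensity matrix on the finite state space `ι` all of whose states are transient:
the off-diagonal entries (jump rates) and the absorption rates are nonnegative, and from every state
one can reach, by jumps of positive rate, a state from which absorption occurs at positive rate. -/
structure IsSubIntensity {ι : Type*} [Fintype ι] (T : Matrix ι ι ℝ) : Prop where
  offDiag_nonneg : ∀ i j, i ≠ j → 0 ≤ T i j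
  exit_nonneg : ∀ i, 0 ≤ exitRates T i
  transient : ∀ i, ∃ j,
    Relation.ReflTransGen (fun a b => a ≠ b ∧ 0 < T a b) i j ∧ 0 < exitRates T j

/-- The measure `ν` on the line is the fractional phase-type distribution `PH_α(π, T)`: it is
carried by `[0, ∞)` and its Laplace transform at `u ≥ 0` is `π (u^α I - T)⁻¹ t`, where `t = -T e`.
The initial vector may be defective (`π e ≤ 1`); the total mass of `ν` is then `π e`. -/
structure IsFracPH {ι : Type*} [Fintype ι] [DecidableEq ι]
    (ν : Measure ℝ) (α : ℝ) (π : ι → ℝ) (T : Matrix ι ι ℝ) : Prop where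
  alpha_pos : 0 < α
  alpha_le_one : α ≤ 1
  init_nonneg : ∀ i, 0 ≤ π i
  init_sum_le : ∑ i, π i ≤ 1
  subIntensity : IsSubIntensity T
  finite : IsFiniteMeasure ν
  nonneg : ∀ᵐ x ∂ν, 0 ≤ x
  laplace : ∀ u : ℝ, 0 ≤ u →
    ∫ x, Real.exp (-(u * x)) ∂ν =
      π ⬝ᵥ ((u ^ α • (1 : Matrix ι ι ℝ) - T)⁻¹ *ᵥ exitRates T)

/-- The measure `μ` on `ℝⁿ` is the multivariate fractional phase-type distribution
`MPH*_α(π, T, R)`: it is a probability measure carried by the nonnegative orthant whose joint Laplace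
transform at `θ ≥ 0` is `π (Δ(Rθ)^α - T)⁻¹ t`, where `t = -T e`. Here `π` is a probability vector,
`T` a sub-intensity matrix and `R` a nonnegative reward matrix. -/
structure IsMultiFracPH {p n : ℕ} (μ : Measure (Fin n → ℝ)) (α : ℝ)
    (π : Fin p → ℝ) (T : Matrix (Fin p) (Fin p) ℝ) (R : Matrix (Fin p) (Fin n) ℝ) : Prop where
  alpha_pos : 0 < α
  alpha_le_one : α ≤ 1
  init_nonneg : ∀ i, 0 ≤ π i
  init_sum : ∑ i, π i = 1
  subIntensity : IsSubIntensity T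
  reward_nonneg : ∀ i k, 0 ≤ R i k
  prob : IsProbabilityMeasure μ
  nonneg : ∀ᵐ y ∂μ, ∀ k, 0 ≤ y k
  laplace : ∀ θ : Fin n → ℝ, (∀ k, 0 ≤ θ k) →
    ∫ y, Real.exp (-(y ⬝ᵥ θ)) ∂μ =
      π ⬝ᵥ ((Matrix.diagonal (fun i => (R *ᵥ θ) i ^ α) - T)⁻¹ *ᵥ exitRates T)

section Blocks

variable {p : ℕ} (T : Matrix (Fin p) (Fin p) ℝ) (r : Fin p → ℝ)

/-- The states of `E₊`, where the reward rate `r` is positive. -/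
abbrev PosStates (r : Fin p → ℝ) : Type := {i : Fin p // 0 < r i}

/-- The states of `E₀`, where the reward rate `r` vanishes. -/
abbrev ZeroStates (r : Fin p → ℝ) : Type := {i : Fin p // r i = 0}

/-- The block `T₊₊`. -/
def blockPP : Matrix (PosStates r) (PosStates r) ℝ := T.submatrix (↑) (↑)

/-- The block `T₊₀`. -/
def blockPZ : Matrix (PosStates r) (ZeroStates r) ℝ := T.submatrix (↑) (↑)

/-- The block `T₀₊`. -/
def blockZP : Matrix (ZeroStates r) (PosStates r) ℝ := T.submatrix (↑) (↑)

/-- The block `T₀₀`. -/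
def blockZZ : Matrix (ZeroStates r) (ZeroStates r) ℝ := T.submatrix (↑) (↑)

/-- The initial vector `π₊ + π₀ (-T₀₀)⁻¹ T₀₊`; for `r = R w` it is `π_w`. -/
def projInit (π : Fin p → ℝ) : PosStates r → ℝ :=
  (fun i : PosStates r => π i) + (fun i : ZeroStates r => π i) ᵥ* ((-blockZZ T r)⁻¹ * blockZP T r)

/-- The matrix `Δ(r₊^α)⁻¹ (T₊₊ + T₊₀ (-T₀₀)⁻¹ T₀₊)`; for `r = R w` it is `T_w`. -/
def projMatrix (α : ℝ) : Matrix (PosStates r) (PosStates r) ℝ :=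
  (Matrix.diagonal (fun i : PosStates r => r i ^ α))⁻¹ *
    (blockPP T r + blockPZ T r * (-blockZZ T r)⁻¹ * blockZP T r)

end Blocks

end

/-! With `r = R w`, the Laplace transform of ⟨Y, w⟩ at `u` is the joint transform at `u w`, namely π
(u^α Δ(r^α) - T)⁻¹ t. On E₀ the diagonal term vanishes, so a Schur complement eliminates these
states. What remains is the constant π₀(-T₀₀)⁻¹t₀ = 1 - π_w e plus the transform of PH_α(π_w, T_w)
(`dotProduct_resolvent_eq`). The second summand tends to 0 as u → ∞, so the constant is the mass of
the atom at zero.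

Invertibility, positivity of inverses and transience of the reduced matrices all come from one
maximum principle: `T x ≥ 0` forces `x ≤ 0`. Its converse for nonnegative `x` characterises
transience, so the reduced matrices inherit it by extending vectors to all states.

Absolute continuity on (0, ∞) is proved analytically. By the identity theorem the transform equals c
+ ℓ((z^α - S)⁻¹) on a right half-plane, where ℓ is a linear functional. The transform minus c is
only O(|z|^(-α)), but its derivative is O(|z|^(-1-α)), which is integrable along vertical lines.
Hence x e^(-(M+1)x) μ(dx) has integrable characteristic function and is absolutely continuous, and
its weight is positive on (0, ∞). -/

/-! ### Maximum principle and transience -/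

section SubIntensity

open Matrix

variable {ι : Type*} [Fintype ι] {T : Matrix ι ι ℝ}

theorem exitRates_apply (T : Matrix ι ι ℝ) (i : ι) : exitRates T i = -∑ j, T i j := by
  simp [exitRates, mulVec, dotProduct]

/-- The maximum principle for sub-intensity matrices with transient states. -/
theorem IsSubIntensity.nonpos_of_diagonal_mul_le (hT : IsSubIntensity T) {d x : ι → ℝ}
    (hd : ∀ i, 0 ≤ d i) (hx : ∀ i, d i * x i ≤ (T *ᵥ x) i) (i : ι) : x i ≤ 0 := by
  classical
  by_contra! hi
  obtain ⟨m, -, hm⟩ := Finset.exists_max_image Finset.univ x ⟨i, Finset.mem_univ i⟩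
  have hm' : ∀ j, x j ≤ x m := fun j => hm j (Finset.mem_univ j)
  have hmpos : 0 < x m := hi.trans_le (hm' i)
  -- At a positive maximum every term in the row identity has a sign, so all of them vanish: no
  -- absorption occurs there and every neighbour is again a maximum. This contradicts the path to
  -- absorption.
  have key : ∀ k, x k = x m → exitRates T k = 0 ∧ ∀ j, k ≠ j → 0 < T k j → x j = x m := by
    intro k hk
    have h1 : (T *ᵥ x) k = -(exitRates T k * x m) - ∑ j, T k j * (x m - x j) := by
      simp only [exitRates_apply, mulVec, dotProduct, mul_sub, Finset.sum_sub_distrib,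
        ← Finset.sum_mul]
      ring
    have hnn : ∀ j ∈ Finset.univ, 0 ≤ T k j * (x m - x j) := by
      intro j _
      rcases eq_or_ne k j with rfl | hkj
      · simp [hk]
      · exact mul_nonneg (hT.offDiag_nonneg k j hkj) (sub_nonneg.2 (hm' j))
    have h2 := Finset.sum_nonneg hnn
    have h3 : 0 ≤ exitRates T k * x m := mul_nonneg (hT.exit_nonneg k) hmpos.le
    have h4 : 0 ≤ d k * x k := mul_nonneg (hd k) (hk ▸ hmpos.le)
    have h5 := hx k
    have h6 : exitRates T k * x m = 0 := by linarith
    have h7 : ∑ j, T k j * (x m - x j) = 0 := by linarith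
    refine ⟨(mul_eq_zero.1 h6).resolve_right hmpos.ne', fun j _ hj => ?_⟩
    have := (Finset.sum_eq_zero_iff_of_nonneg hnn).1 h7 j (Finset.mem_univ j)
    linarith [(mul_eq_zero.1 this).resolve_left hj.ne']
  obtain ⟨j, hpath, hj⟩ := hT.transient m
  have hreach : ∀ k, Relation.ReflTransGen (fun a b => a ≠ b ∧ 0 < T a b) m k → x k = x m := by
    intro k hk
    induction hk with
    | refl => rfl
    | tail _ hbc ih => exact (key _ ih).2 _ hbc.1 hbc.2
  exact hj.ne' (key j (hreach j hpath)).1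

theorem IsSubIntensity.nonpos_of_mulVec_nonneg (hT : IsSubIntensity T) {x : ι → ℝ}
    (hx : ∀ i, 0 ≤ (T *ᵥ x) i) (i : ι) : x i ≤ 0 :=
  hT.nonpos_of_diagonal_mul_le (d := 0) (by simp) (by simpa using hx) i

/-- A matrix of jump rates for which every nonnegative subharmonic vector vanishes has only
transient states. -/
theorem IsSubIntensity.of_nonpos (hoff : ∀ i j, i ≠ j → 0 ≤ T i j)
    (hexit : ∀ i, 0 ≤ exitRates T i)
    (h : ∀ x : ι → ℝ, (∀ i, 0 ≤ x i) → (∀ i, 0 ≤ (T *ᵥ x) i) → ∀ i, x i ≤ 0) :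
    IsSubIntensity T := by
  classical
  refine ⟨hoff, hexit, fun i => ?_⟩
  by_contra! hi
  -- If no absorbing exit is reachable from `i`, the reachable set is closed and its indicator is
  -- subharmonic, yet equals 1 at `i`.
  set C : Set ι := {j | Relation.ReflTransGen (fun a b => a ≠ b ∧ 0 < T a b) i j} with hC
  have hx := h (C.indicator 1) (fun j => Set.indicator_nonneg (fun _ _ => zero_le_one) j) ?_ i
  · rw [Set.indicator_of_mem (show i ∈ C from Relation.ReflTransGen.refl)] at hx
    exact absurd hx (by simp)
  · intro k
    by_cases hk : k ∈ C
    · have h0 : exitRates T k = 0 := le_antisymm (hi k hk) (hexit k)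
      have : (T *ᵥ C.indicator 1) k = ∑ j, T k j := by
        simp only [mulVec, dotProduct]
        refine Finset.sum_congr rfl fun j _ => ?_
        by_cases hj : j ∈ C
        · simp [hj]
        · have hkj : k ≠ j := fun e => hj (e ▸ hk)
          have : ¬ 0 < T k j := fun hpos => hj (Relation.ReflTransGen.tail hk ⟨hkj, hpos⟩)
          simp [hj, le_antisymm (not_lt.1 this) (hoff k j hkj)]
      rw [exitRates_apply] at h0
      linarith
    · refine Finset.sum_nonneg fun j _ => ?_
      by_cases hj : j ∈ C
      · simpa [hj] using hoff k j fun e => hk (e ▸ hj)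
      · simp [hj]

variable [DecidableEq ι]

/-- The maximum principle applies to a kernel vector and to its negative. -/
theorem IsSubIntensity.isUnit_diagonal_sub (hT : IsSubIntensity T) {d : ι → ℝ}
    (hd : ∀ i, 0 ≤ d i) : IsUnit (diagonal d - T) := by
  rw [← mulVec_injective_iff_isUnit]
  intro x y hxy
  have hz : ∀ i, d i * (x - y) i = (T *ᵥ (x - y)) i := by
    intro i
    have := congrFun hxy i
    simp only [sub_mulVec, Pi.sub_apply, mulVec_diagonal, mulVec_sub] at this ⊢
    linarith
  have h1 := hT.nonpos_of_diagonal_mul_le hd (x := x - y) (fun i => (hz i).le)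
  have h2 := hT.nonpos_of_diagonal_mul_le hd (x := -(x - y)) (fun i => by
    rw [mulVec_neg, Pi.neg_apply, Pi.neg_apply, ← hz i, mul_neg])
  funext i
  have a := h1 i
  have b := h2 i
  simp only [Pi.sub_apply, Pi.neg_apply] at a b
  linarith

theorem IsSubIntensity.isUnit_neg (hT : IsSubIntensity T) : IsUnit (-T) := by
  simpa using hT.isUnit_diagonal_sub (d := 0) (by simp)

theorem IsSubIntensity.isUnit_smul_one_sub (hT : IsSubIntensity T) {v : ℝ} (hv : 0 ≤ v) :
    IsUnit (v • (1 : Matrix ι ι ℝ) - T) := by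
  rw [smul_one_eq_diagonal]
  exact hT.isUnit_diagonal_sub fun _ => hv

/-- `T` maps `-(-T)⁻¹ v` to `v ≥ 0`, so that vector is nonpositive. -/
theorem IsSubIntensity.neg_inv_mulVec_nonneg (hT : IsSubIntensity T) {v : ι → ℝ}
    (hv : ∀ i, 0 ≤ v i) (i : ι) : 0 ≤ ((-T)⁻¹ *ᵥ v) i := by
  have hdet := (isUnit_iff_isUnit_det _).1 hT.isUnit_neg
  have := hT.nonpos_of_mulVec_nonneg (x := -((-T)⁻¹ *ᵥ v)) (fun j => by
    rw [mulVec_neg, ← neg_mulVec, mulVec_mulVec, mul_nonsing_inv _ hdet, one_mulVec]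
    exact hv j) i
  simpa using this

theorem IsSubIntensity.neg_inv_nonneg (hT : IsSubIntensity T) (i j : ι) : 0 ≤ (-T)⁻¹ i j := by
  have := hT.neg_inv_mulVec_nonneg (v := Pi.single j 1)
    (fun k => by
      by_cases h : k = j
      · simp [h]
      · simp [h]) i
  simpa using this

theorem IsSubIntensity.diagonal_mul (hT : IsSubIntensity T) {c : ι → ℝ} (hc : ∀ i, 0 < c i) :
    IsSubIntensity (diagonal c * T) := by
  refine .of_nonpos (fun i j hij => ?_) (fun i => ?_) fun x _ hx => ?_
  · rw [Matrix.diagonal_mul]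
    exact mul_nonneg (hc i).le (hT.offDiag_nonneg i j hij)
  · have : exitRates (diagonal c * T) i = c i * exitRates T i := by
      simp [exitRates_apply, Matrix.diagonal_mul, Finset.mul_sum]
    rw [this]
    exact mul_nonneg (hc i).le (hT.exit_nonneg i)
  · refine hT.nonpos_of_mulVec_nonneg fun i => ?_
    have := hx i
    rw [← mulVec_mulVec, mulVec_diagonal] at this
    exact nonneg_of_mul_nonneg_right this (hc i)

end SubIntensity

/-! ### Elimination of the states without reward -/

section BlockElimination

open Matrix

variable {p : ℕ} {T : Matrix (Fin p) (Fin p) ℝ} {r : Fin p → ℝ}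

theorem sum_posStates_add_sum_zeroStates (hr : ∀ i, 0 ≤ r i) (f : Fin p → ℝ) :
    ∑ i : PosStates r, f i + ∑ i : ZeroStates r, f i = ∑ i, f i := by
  classical
  rw [← Finset.sum_filter_add_sum_filter_not Finset.univ (fun i => 0 < r i) f]
  congr 1
  · exact (Finset.sum_subtype _ (by simp) f).symm
  · refine (Finset.sum_subtype _ (fun i => ?_) f).symm
    simpa using ⟨fun h => le_antisymm h (hr i), fun h => h.le⟩

/-- The vector with prescribed restrictions to `E₊` and `E₀`. -/
noncomputable def glueStates (r : Fin p → ℝ) (a : PosStates r → ℝ) (b : ZeroStates r → ℝ) :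
    Fin p → ℝ :=
  fun i => if h : 0 < r i then a ⟨i, h⟩ else if h : r i = 0 then b ⟨i, h⟩ else 0

@[simp] theorem glueStates_pos (a : PosStates r → ℝ) (b : ZeroStates r → ℝ) (i : PosStates r) :
    glueStates r a b i = a i := by
  simp [glueStates, i.2]

@[simp] theorem glueStates_zero (a : PosStates r → ℝ) (b : ZeroStates r → ℝ) (i : ZeroStates r) :
    glueStates r a b i = b i := by
  simp [glueStates, i.2]

theorem forall_states (hr : ∀ i, 0 ≤ r i) {q : Fin p → Prop} (h1 : ∀ i : PosStates r, q i)
    (h0 : ∀ i : ZeroStates r, q i) (i : Fin p) : q i := by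
  rcases (hr i).lt_or_eq with h | h
  · exact h1 ⟨i, h⟩
  · exact h0 ⟨i, h.symm⟩

theorem mulVec_glueStates_pos (hr : ∀ i, 0 ≤ r i) (a : PosStates r → ℝ) (b : ZeroStates r → ℝ)
    (i : PosStates r) :
    (T *ᵥ glueStates r a b) i = (blockPP T r *ᵥ a + blockPZ T r *ᵥ b) i := by
  simp [mulVec, dotProduct, ← sum_posStates_add_sum_zeroStates hr, blockPP, blockPZ]

theorem mulVec_glueStates_zero (hr : ∀ i, 0 ≤ r i) (a : PosStates r → ℝ) (b : ZeroStates r → ℝ)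
    (i : ZeroStates r) :
    (T *ᵥ glueStates r a b) i = (blockZP T r *ᵥ a + blockZZ T r *ᵥ b) i := by
  simp [mulVec, dotProduct, ← sum_posStates_add_sum_zeroStates hr, blockZP, blockZZ]

theorem dotProduct_glueStates (hr : ∀ i, 0 ≤ r i) (π : Fin p → ℝ) (a : PosStates r → ℝ)
    (b : ZeroStates r → ℝ) :
    π ⬝ᵥ glueStates r a b =
      (fun i : PosStates r => π i) ⬝ᵥ a + (fun i : ZeroStates r => π i) ⬝ᵥ b := by
  simp [dotProduct, ← sum_posStates_add_sum_zeroStates hr]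

theorem glueStates_one (hr : ∀ i, 0 ≤ r i) : glueStates r 1 1 = 1 := by
  funext i
  exact forall_states hr (q := fun i => glueStates r 1 1 i = (1 : Fin p → ℝ) i)
    (by simp) (by simp) i

theorem exitRates_pos (hr : ∀ i, 0 ≤ r i) (T : Matrix (Fin p) (Fin p) ℝ) (i : PosStates r) :
    exitRates T i = -(blockPP T r *ᵥ 1 + blockPZ T r *ᵥ 1) i := by
  rw [exitRates, Pi.neg_apply, ← glueStates_one hr, mulVec_glueStates_pos hr]

theorem exitRates_zero (hr : ∀ i, 0 ≤ r i) (T : Matrix (Fin p) (Fin p) ℝ) (i : ZeroStates r) :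
    exitRates T i = -(blockZP T r *ᵥ 1 + blockZZ T r *ᵥ 1) i := by
  rw [exitRates, Pi.neg_apply, ← glueStates_one hr, mulVec_glueStates_zero hr]

theorem IsSubIntensity.blockZP_nonneg (hT : IsSubIntensity T) (i : ZeroStates r)
    (j : PosStates r) : 0 ≤ blockZP T r i j :=
  hT.offDiag_nonneg _ _ fun h => j.2.ne' (h ▸ i.2)

theorem IsSubIntensity.blockPZ_nonneg (hT : IsSubIntensity T) (i : PosStates r)
    (j : ZeroStates r) : 0 ≤ blockPZ T r i j :=
  hT.offDiag_nonneg _ _ fun h => i.2.ne' (h ▸ j.2)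

theorem mulVec_nonneg_of_nonneg {m n : Type*} [Fintype n] {A : Matrix m n ℝ} {x : n → ℝ}
    (hA : ∀ i j, 0 ≤ A i j) (hx : ∀ j, 0 ≤ x j) (i : m) : 0 ≤ (A *ᵥ x) i :=
  Finset.sum_nonneg fun j _ => mul_nonneg (hA i j) (hx j)

theorem mul_nonneg_of_nonneg {l m n : Type*} [Fintype m] {A : Matrix l m ℝ} {B : Matrix m n ℝ}
    (hA : ∀ i j, 0 ≤ A i j) (hB : ∀ i j, 0 ≤ B i j) (i : l) (j : n) : 0 ≤ (A * B) i j :=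
  Finset.sum_nonneg fun k _ => mul_nonneg (hA i k) (hB k j)

theorem IsSubIntensity.toBlockZZ (hT : IsSubIntensity T) (hr : ∀ i, 0 ≤ r i) :
    IsSubIntensity (blockZZ T r) := by
  refine .of_nonpos (fun i j hij => hT.offDiag_nonneg _ _ fun h => hij (Subtype.ext h))
    (fun i => ?_) fun x hx0 hx => ?_
  · have h1 := exitRates_zero hr T i
    have h2 := hT.exit_nonneg i
    have h3 := mulVec_nonneg_of_nonneg (hT.blockZP_nonneg (r := r)) (x := 1)
      (fun _ => zero_le_one) i
    simp only [exitRates, Pi.neg_apply, Pi.add_apply] at h1 h2 ⊢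
    linarith
  -- Extension by zero stays subharmonic: the rows in E₊ only see `T₊₀ x`, which is nonnegative
  -- because `x` is.
  · have := hT.nonpos_of_mulVec_nonneg (x := glueStates r 0 x) (forall_states hr
      (fun i => ?_) fun i => ?_)
    · exact fun i => by simpa using this i
    · rw [mulVec_glueStates_pos hr]
      simpa using mulVec_nonneg_of_nonneg hT.blockPZ_nonneg hx0 i
    · rw [mulVec_glueStates_zero hr]
      simpa using hx i

/-- The rates of the jump chain watched only while it is in `E₊`. -/
noncomputable def censoredMatrix (T : Matrix (Fin p) (Fin p) ℝ) (r : Fin p → ℝ) :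
    Matrix (PosStates r) (PosStates r) ℝ :=
  blockPP T r + blockPZ T r * (-blockZZ T r)⁻¹ * blockZP T r

theorem isUnit_det_neg_blockZZ (hT : IsSubIntensity T) (hr : ∀ i, 0 ≤ r i) :
    IsUnit (-blockZZ T r).det :=
  (isUnit_iff_isUnit_det _).1 (hT.toBlockZZ hr).isUnit_neg

/-- Started in E₀, the chain is either absorbed before visiting E₊ (left side) or enters E₊ first
(subtracted term). -/
theorem neg_inv_blockZZ_mulVec_exitRates (hT : IsSubIntensity T) (hr : ∀ i, 0 ≤ r i) :
    (-blockZZ T r)⁻¹ *ᵥ (fun i : ZeroStates r => exitRates T i) =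
      1 - (-blockZZ T r)⁻¹ *ᵥ (blockZP T r *ᵥ 1) := by
  have : (fun i : ZeroStates r => exitRates T i) =
      (-blockZZ T r) *ᵥ 1 - blockZP T r *ᵥ 1 := by
    funext i
    rw [exitRates_zero hr]
    simp [neg_mulVec]
    ring
  rw [this, mulVec_sub, mulVec_mulVec, nonsing_inv_mul _ (isUnit_det_neg_blockZZ hT hr),
    one_mulVec]

/-- The value on E₀ is chosen to solve the E₀ rows. The case `c = 0` is the harmonic extension that
gives transience of the censored chain; `c = t₀` solves the resolvent equation. -/
theorem mulVec_glueStates_censored (hT : IsSubIntensity T) (hr : ∀ i, 0 ≤ r i)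
    (a : PosStates r → ℝ) (c : ZeroStates r → ℝ) :
    T *ᵥ glueStates r a ((-blockZZ T r)⁻¹ *ᵥ (blockZP T r *ᵥ a + c)) =
      glueStates r (censoredMatrix T r *ᵥ a + blockPZ T r *ᵥ ((-blockZZ T r)⁻¹ *ᵥ c)) (-c) := by
  funext i
  revert i
  refine forall_states hr (fun i => ?_) fun i => ?_
  · rw [mulVec_glueStates_pos hr, glueStates_pos, censoredMatrix]
    simp only [mulVec_add, add_mulVec, mulVec_mulVec, Matrix.mul_assoc, Pi.add_apply]
    ring
  · have : blockZZ T r *ᵥ ((-blockZZ T r)⁻¹ *ᵥ (blockZP T r *ᵥ a + c)) =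
        -(blockZP T r *ᵥ a + c) := by
      rw [← neg_neg (blockZZ T r *ᵥ _), ← neg_mulVec, mulVec_mulVec,
        mul_nonsing_inv _ (isUnit_det_neg_blockZZ hT hr), one_mulVec]
    rw [mulVec_glueStates_zero hr, glueStates_zero, this]
    simp

/-- The censored chain exits directly from E₊ or through an excursion in E₀ that ends in absorption.
-/
theorem exitRates_censoredMatrix (hT : IsSubIntensity T) (hr : ∀ i, 0 ≤ r i) :
    exitRates (censoredMatrix T r) = (fun i : PosStates r => exitRates T i) +
      blockPZ T r *ᵥ ((-blockZZ T r)⁻¹ *ᵥ fun i : ZeroStates r => exitRates T i) := by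
  rw [neg_inv_blockZZ_mulVec_exitRates hT hr]
  funext i
  simp only [Pi.add_apply, exitRates_pos hr]
  simp only [exitRates, censoredMatrix, add_mulVec, mulVec_sub, ← mulVec_mulVec, Pi.add_apply,
    Pi.neg_apply, Pi.sub_apply]
  ring

theorem IsSubIntensity.toCensored (hT : IsSubIntensity T) (hr : ∀ i, 0 ≤ r i) :
    IsSubIntensity (censoredMatrix T r) := by
  refine .of_nonpos (fun i j hij => ?_) (fun i => ?_) fun x _ hx => ?_
  · exact add_nonneg (hT.offDiag_nonneg _ _ fun h => hij (Subtype.ext h))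
      (mul_nonneg_of_nonneg (mul_nonneg_of_nonneg hT.blockPZ_nonneg
        (hT.toBlockZZ hr).neg_inv_nonneg) hT.blockZP_nonneg i j)
  · rw [exitRates_censoredMatrix hT hr]
    exact add_nonneg (hT.exit_nonneg i) (mulVec_nonneg_of_nonneg hT.blockPZ_nonneg
      ((hT.toBlockZZ hr).neg_inv_mulVec_nonneg fun j => hT.exit_nonneg j) i)
  · have := hT.nonpos_of_mulVec_nonneg
      (x := glueStates r x ((-blockZZ T r)⁻¹ *ᵥ (blockZP T r *ᵥ x + 0))) ?_
    · exact fun i => by simpa using this i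
    · rw [mulVec_glueStates_censored hT hr]
      exact forall_states hr (by simpa using hx) (by simp)

theorem projMatrix_eq (T : Matrix (Fin p) (Fin p) ℝ) (r : Fin p → ℝ) (α : ℝ) :
    projMatrix T r α =
      diagonal (fun i : PosStates r => (r i ^ α)⁻¹) * censoredMatrix T r := by
  rw [projMatrix, censoredMatrix]
  congr 1
  refine inv_eq_left_inv ?_
  rw [diagonal_mul_diagonal, ← diagonal_one]
  congr 1
  funext i
  exact inv_mul_cancel₀ (Real.rpow_pos_of_pos i.2 α).ne'

theorem IsSubIntensity.toProj (hT : IsSubIntensity T) (hr : ∀ i, 0 ≤ r i) (α : ℝ) :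
    IsSubIntensity (projMatrix T r α) := by
  rw [projMatrix_eq]
  exact (hT.toCensored hr).diagonal_mul fun i => inv_pos.2 (Real.rpow_pos_of_pos i.2 α)

theorem projInit_nonneg (hT : IsSubIntensity T) (hr : ∀ i, 0 ≤ r i) {π : Fin p → ℝ}
    (hπ : ∀ i, 0 ≤ π i) (i : PosStates r) : 0 ≤ projInit T r π i :=
  add_nonneg (hπ i) (dotProduct_nonneg_of_nonneg (fun j => hπ j) fun j =>
    mul_nonneg_of_nonneg (hT.toBlockZZ hr).neg_inv_nonneg hT.blockZP_nonneg j i)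

theorem projInit_dotProduct (π : Fin p → ℝ) (f : PosStates r → ℝ) :
    projInit T r π ⬝ᵥ f = (fun i : PosStates r => π i) ⬝ᵥ f +
      (fun i : ZeroStates r => π i) ⬝ᵥ ((-blockZZ T r)⁻¹ *ᵥ (blockZP T r *ᵥ f)) := by
  rw [projInit, add_dotProduct, ← dotProduct_mulVec, mulVec_mulVec]

/-- The missing mass is the probability of absorption before any visit to E₊, that is, of collecting
no reward. -/
theorem one_sub_sum_projInit (hT : IsSubIntensity T) (hr : ∀ i, 0 ≤ r i) {π : Fin p → ℝ}
    (hπ : ∑ i, π i = 1) :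
    1 - ∑ i, projInit T r π i = (fun i : ZeroStates r => π i) ⬝ᵥ
      ((-blockZZ T r)⁻¹ *ᵥ fun i : ZeroStates r => exitRates T i) := by
  rw [neg_inv_blockZZ_mulVec_exitRates hT hr, ← dotProduct_one, projInit_dotProduct,
    dotProduct_sub, dotProduct_one, dotProduct_one, ← hπ, ← sum_posStates_add_sum_zeroStates hr]
  ring

theorem sum_projInit_le_one (hT : IsSubIntensity T) (hr : ∀ i, 0 ≤ r i) {π : Fin p → ℝ}
    (hπ0 : ∀ i, 0 ≤ π i) (hπ : ∑ i, π i = 1) : ∑ i, projInit T r π i ≤ 1 := by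
  rw [← sub_nonneg, one_sub_sum_projInit hT hr hπ]
  exact Finset.sum_nonneg fun i _ => mul_nonneg (hπ0 i)
    ((hT.toBlockZZ hr).neg_inv_mulVec_nonneg (fun j => hT.exit_nonneg j) i)

/-- Elimination of the states without reward from the resolvent expression. -/
theorem dotProduct_resolvent_eq (hT : IsSubIntensity T) (hr : ∀ i, 0 ≤ r i) {π : Fin p → ℝ}
    (hπ : ∑ i, π i = 1) {α v : ℝ} (hα : 0 < α) (hv : 0 ≤ v) :
    π ⬝ᵥ ((diagonal (fun i => v * r i ^ α) - T)⁻¹ *ᵥ exitRates T) =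
      1 - ∑ i, projInit T r π i + projInit T r π ⬝ᵥ
        ((v • (1 : Matrix (PosStates r) (PosStates r) ℝ) - projMatrix T r α)⁻¹ *ᵥ
          exitRates (projMatrix T r α)) := by
  set f := (v • (1 : Matrix (PosStates r) (PosStates r) ℝ) - projMatrix T r α)⁻¹ *ᵥ
          exitRates (projMatrix T r α) with hf
  have hfeq : ∀ i : PosStates r,
      v * r i ^ α * f i - (censoredMatrix T r *ᵥ f) i = exitRates (censoredMatrix T r) i := by
    intro i
    have h1 : (v • (1 : Matrix (PosStates r) (PosStates r) ℝ) - projMatrix T r α) *ᵥ f =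
        exitRates (projMatrix T r α) := by
      rw [hf, mulVec_mulVec, mul_nonsing_inv _ ((isUnit_iff_isUnit_det _).1
        ((hT.toProj hr α).isUnit_smul_one_sub hv)), one_mulVec]
    have h2 := congrFun h1 i
    have hpos := Real.rpow_pos_of_pos i.2 α
    simp only [exitRates, projMatrix_eq, sub_mulVec, ← mulVec_mulVec, Pi.sub_apply, Pi.neg_apply,
      mulVec_diagonal, smul_mulVec, one_mulVec, Pi.smul_apply, smul_eq_mul] at h2 ⊢
    field_simp at h2
    linarith
  set t0 : ZeroStates r → ℝ := fun i => exitRates T i with ht0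
  -- The full resolvent vector is recovered from its E₊ part `f`; on E₀ the diagonal drops out since
  -- `0 ^ α = 0` for `α > 0`.
  have hsol : (diagonal (fun i => v * r i ^ α) - T) *ᵥ
      glueStates r f ((-blockZZ T r)⁻¹ *ᵥ (blockZP T r *ᵥ f + t0)) = exitRates T := by
    rw [sub_mulVec, mulVec_glueStates_censored hT hr]
    funext i
    revert i
    refine forall_states hr (fun i => ?_) fun i => ?_
    · have h1 := hfeq i
      rw [exitRates_censoredMatrix hT hr] at h1
      simp only [Pi.sub_apply, mulVec_diagonal, glueStates_pos, Pi.add_apply] at h1 ⊢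
      linarith
    · simp [mulVec_diagonal, i.2, Real.zero_rpow hα.ne', ht0]
  have hunit : IsUnit (diagonal (fun i => v * r i ^ α) - T) :=
    hT.isUnit_diagonal_sub fun i => mul_nonneg hv (Real.rpow_nonneg (hr i) α)
  rw [← hsol, mulVec_mulVec, nonsing_inv_mul _ ((isUnit_iff_isUnit_det _).1 hunit), one_mulVec,
    dotProduct_glueStates hr, mulVec_add, dotProduct_add, one_sub_sum_projInit hT hr hπ,
    projInit_dotProduct]
  ring

end BlockElimination

/-! ### Absolute continuity from an integrable characteristic function -/

section FourierDensity

open scoped FourierTransform SchwartzMap RealInnerProductSpace ContDiff Manifold ENNReal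

variable {E : Type*} [NormedAddCommGroup E] [InnerProductSpace ℝ E] [FiniteDimensional ℝ E]
  [MeasurableSpace E] [BorelSpace E]

/-- Integrating a Schwartz function against a finite measure with integrable characteristic
function costs at most a constant times its `L¹` norm. -/
theorem norm_integral_schwartz_le_of_integrable_charFun (κ : Measure E) [IsFiniteMeasure κ]
    (hκ : Integrable (charFun κ)) :
    ∃ C : ℝ, 0 ≤ C ∧ ∀ h : 𝓢(E, ℂ), ‖∫ x, h x ∂κ‖ ≤ C * ∫ x, ‖h x‖ := by
  set F : E → ℂ := fun ξ => VectorFourier.fourierIntegral Real.fourierChar κ (innerₗ E) 1 ξ with hF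
  have hFeq : F = fun ξ => charFun κ ((-(2 * Real.pi)) • ξ) := by
    funext ξ
    rw [charFun_eq_fourierIntegral', smul_smul]
    have : -(2 * Real.pi)⁻¹ * -(2 * Real.pi) = 1 := by
      have := Real.pi_ne_zero
      field_simp
    rw [this, one_smul]
  have hFint : Integrable F := by
    rw [hFeq]
    exact hκ.comp_smul (by simp [Real.pi_ne_zero])
  refine ⟨∫ ξ, ‖F ξ‖, integral_nonneg fun _ => norm_nonneg _, fun h => ?_⟩
  -- Writing `h` as the Fourier transform of `g`, Fubini moves the transform onto `κ`, and the sup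
  -- norm of `g` is at most the L¹ norm of `h`.
  set g : 𝓢(E, ℂ) := 𝓕⁻ h with hg
  have hgh : ∀ x, h x =
      VectorFourier.fourierIntegral Real.fourierChar volume (innerₗ E).flip g x := by
    intro x
    have h1 : h = 𝓕 g := by rw [hg]; simp
    conv_lhs => rw [h1]
    rw [SchwartzMap.fourier_coe, Real.fourier_eq, VectorFourier.fourierIntegral]
    simp
  have hswap := VectorFourier.integral_fourierIntegral_smul_eq_flip (μ := κ) (ν := volume)
    (L := innerₗ E) (f := (1 : E → ℂ)) (g := g) Real.continuous_fourierChar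
    (by simpa using! continuous_inner) (by simpa using! integrable_const (1 : ℂ)) g.integrable
  have hgle : ∀ ξ, ‖g ξ‖ ≤ ∫ x, ‖h x‖ := by
    intro ξ
    rw [hg, SchwartzMap.fourierInv_coe, Real.fourierInv_eq]
    refine (norm_integral_le_integral_norm _).trans (le_of_eq ?_)
    simp
  have : ∫ x, h x ∂κ = ∫ ξ, F ξ • g ξ := by
    rw [hF, hswap]
    exact integral_congr_ae (.of_forall fun x => by
      simp only [hgh x, Pi.one_apply, one_smul])
  rw [this, ← integral_mul_const]
  refine (norm_integral_le_integral_norm _).trans (integral_mono_of_nonneg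
    (.of_forall fun _ => norm_nonneg _) (hFint.norm.mul_const _) (.of_forall fun ξ => ?_))
  simp only [norm_smul]
  exact mul_le_mul_of_nonneg_left (hgle ξ) (norm_nonneg _)

/-- A finite measure with integrable characteristic function is absolutely continuous. -/
theorem absolutelyContinuous_of_integrable_charFun (κ : Measure E) [IsFiniteMeasure κ]
    (hκ : Integrable (charFun κ)) : κ ≪ volume := by
  obtain ⟨C, hC0, hC⟩ := norm_integral_schwartz_le_of_integrable_charFun κ hκ
  -- A smooth bump equal to 1 on `K` and supported in `U` is the Schwartz test function. Inner
  -- regularity then passes to open sets, outer regularity of the volume to null sets.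
  have hcompact : ∀ K U : Set E, IsCompact K → IsOpen U → K ⊆ U →
      κ K ≤ ENNReal.ofReal C * volume U := by
    intro K U hK hU hKU
    obtain ⟨L, hL, hKL, hLU⟩ := exists_compact_between hK hU hKU
    obtain ⟨f, hf1, hf0, hf⟩ := exists_contMDiffMap_one_nhds_of_subset_interior (n := (⊤ : ℕ∞))
      𝓘(ℝ, E) hK.isClosed hKL
    have hfs : Function.support (fun x => (f x : ℂ)) ⊆ L := by
      intro x hx
      by_contra hxL
      exact hx (by simp [hf0 x hxL])
    have hcs : HasCompactSupport (fun x => (f x : ℂ)) :=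
      HasCompactSupport.of_support_subset_isCompact hL hfs
    have hsm : ContDiff ℝ ∞ (fun x => (f x : ℂ)) :=
      Complex.ofRealCLM.contDiff.comp f.contMDiff.contDiff
    have hb := hC (hcs.toSchwartzMap hsm)
    have hfi : ∀ ρ : Measure E, [IsFiniteMeasureOnCompacts ρ] → Integrable (fun x => f x) ρ := by
      intro ρ _
      refine (f.contMDiff.contDiff.continuous).integrable_of_hasCompactSupport ?_
      refine HasCompactSupport.of_support_subset_isCompact hL fun x hx => ?_
      by_contra hxL
      exact hx (hf0 x hxL)
    simp only [HasCompactSupport.toSchwartzMap_toFun, integral_complex_ofReal, Complex.norm_real,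
      Real.norm_eq_abs] at hb
    have hb' : ∫ x, f x ∂κ ≤ C * ∫ x, f x := by
      refine (le_abs_self _).trans (hb.trans_eq ?_)
      simp_rw [abs_of_nonneg (hf _).1]
    calc κ K = ∫⁻ x in K, 1 ∂κ := by simp
      _ ≤ ∫⁻ x in K, ENNReal.ofReal (f x) ∂κ :=
          setLIntegral_mono' hK.measurableSet fun x hx => by simp [hf1.self_of_nhdsSet x hx]
      _ ≤ ∫⁻ x, ENNReal.ofReal (f x) ∂κ := setLIntegral_le_lintegral _ _
      _ = ENNReal.ofReal (∫ x, f x ∂κ) :=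
          (ofReal_integral_eq_lintegral_ofReal (hfi κ) (.of_forall fun x => (hf x).1)).symm
      _ ≤ ENNReal.ofReal (C * ∫ x, f x) := ENNReal.ofReal_le_ofReal hb'
      _ = ENNReal.ofReal C * ∫⁻ x, ENNReal.ofReal (f x) := by
          rw [ENNReal.ofReal_mul hC0,
            ofReal_integral_eq_lintegral_ofReal (hfi volume) (.of_forall fun x => (hf x).1)]
      _ ≤ ENNReal.ofReal C * ∫⁻ x, U.indicator 1 x := by
          gcongr with x
          by_cases hx : x ∈ U
          · simpa [hx] using (hf x).2
          · simp [hx, hf0 x fun h => hx (hLU h)]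
      _ = ENNReal.ofReal C * volume U := by rw [lintegral_indicator_one hU.measurableSet]
  have hopen : ∀ U : Set E, IsOpen U → κ U ≤ ENNReal.ofReal C * volume U := by
    intro U hU
    rw [hU.measure_eq_iSup_isCompact]
    exact iSup₂_le fun K hKU => iSup_le fun hK => hcompact K U hK hU hKU
  intro s hs
  refine le_antisymm (ENNReal.le_of_forall_pos_le_add fun ε hε _ => ?_) bot_le
  -- The `+ 1` keeps the denominator nonzero when `C = 0`.
  obtain ⟨U, hsU, hUo, hU⟩ := Set.exists_isOpen_lt_of_lt (μ := volume) s
    (ε / (ENNReal.ofReal C + 1)) (by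
      rw [hs]
      exact ENNReal.div_pos (by simpa using hε.ne') (by simp))
  calc κ s ≤ κ U := measure_mono hsU
    _ ≤ ENNReal.ofReal C * volume U := hopen U hUo
    _ ≤ (ENNReal.ofReal C + 1) * (ε / (ENNReal.ofReal C + 1)) := by
        gcongr
        exact le_self_add
    _ = 0 + ε := by rw [zero_add, ENNReal.mul_div_cancel (by simp) (by simp)]

end FourierDensity

/-! ### Decay of the Laplace transform and the density on (0, ∞) -/

section LaplaceDensity

open Filter Set ProbabilityTheory Bornology

variable {A : Type*} [NormedRing A] [NormedAlgebra ℂ A] [CompleteSpace A]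

/-- The resolvent is O(1/|q|) at infinity, and |z^α| = |z|^α holds for real α despite the branch
cut. -/
theorem exists_resolvent_cpow_bound (a : A) {α : ℝ} (hα : 0 < α) :
    ∃ M C : ℝ, 0 ≤ C ∧ ∀ z : ℂ, M ≤ ‖z‖ →
      z ^ (α : ℂ) ∈ resolventSet ℂ a ∧ ‖resolvent a (z ^ (α : ℂ))‖ ≤ C * ‖z‖ ^ (-α) := by
  obtain ⟨C, hC0, hC⟩ := (spectrum.resolvent_isBigO_inv (𝕜 := ℂ) a).exists_nonneg
  have hev := (spectrum.eventually_isUnit_resolvent (𝕜 := ℂ) a).and hC.bound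
  have hlim : Tendsto (fun z : ℂ => z ^ (α : ℂ)) (cobounded ℂ) (cobounded ℂ) := by
    rw [← tendsto_norm_atTop_iff_cobounded]
    simp_rw [Complex.norm_cpow_real]
    exact (tendsto_rpow_atTop hα).comp tendsto_norm_cobounded_atTop
  obtain ⟨M, -, hM⟩ :=
    (atTop_basis.cobounded_of_norm (E := ℂ)).eventually_iff.1 (hlim.eventually hev)
  refine ⟨M, C, hC0, fun z hz => ?_⟩
  obtain ⟨h1, h2⟩ := hM (show z ∈ _ from hz)
  refine ⟨spectrum.isUnit_resolvent.2 h1, h2.trans_eq ?_⟩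
  rw [norm_inv, Complex.norm_cpow_real, Real.rpow_neg (norm_nonneg z)]

theorem hasDerivAt_resolvent_cpow (a : A) (ℓ : A →L[ℂ] ℂ) (c : ℂ) (α : ℝ) {z : ℂ}
    (hz : 0 < z.re) (hza : z ^ (α : ℂ) ∈ resolventSet ℂ a) :
    HasDerivAt (fun z : ℂ => c + ℓ (resolvent a (z ^ (α : ℂ))))
      (ℓ (-(resolvent a (z ^ (α : ℂ))) ^ 2) * (α * z ^ ((α : ℂ) - 1))) z := by
  have h1 : HasDerivAt (fun q => c + ℓ (resolvent a q)) (ℓ (-(resolvent a (z ^ (α : ℂ))) ^ 2))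
      (z ^ (α : ℂ)) :=
    (ℓ.hasFDerivAt.comp_hasDerivAt _ (spectrum.hasDerivAt_resolvent_const_left hza)).const_add c
  have h2 : HasDerivAt (fun z : ℂ => z ^ (α : ℂ)) (α * z ^ ((α : ℂ) - 1)) z := by
    simpa using (hasDerivAt_id z).cpow_const (c := (α : ℂ)) (Or.inl hz)
  exact HasDerivAt.comp (h₂ := fun q => c + ℓ (resolvent a q)) z h1 h2

variable {μ : Measure ℝ} [IsFiniteMeasure μ]

theorem Iic_zero_subset_integrableExpSet (hμ : ∀ᵐ x ∂μ, 0 ≤ x) :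
    Iic 0 ⊆ integrableExpSet id μ := by
  intro t ht
  refine Integrable.of_bound (by fun_prop) 1 ?_
  filter_upwards [hμ] with x hx
  rw [Real.norm_eq_abs, Real.abs_exp, Real.exp_le_one_iff]
  exact mul_nonpos_of_nonpos_of_nonneg ht hx

theorem hasDerivAt_laplace (hμ : ∀ᵐ x ∂μ, 0 ≤ x) {z : ℂ} (hz : 0 < z.re) :
    HasDerivAt (fun z : ℂ => complexMGF id μ (-z)) (-∫ x, (x : ℂ) * Complex.exp (-z * x) ∂μ) z := by
  have hmem : (-z).re ∈ interior (integrableExpSet id μ) := by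
    refine interior_mono (Iic_zero_subset_integrableExpSet hμ) ?_
    simpa using hz
  simpa [Function.comp_def] using! (hasDerivAt_complexMGF hmem).comp z (hasDerivAt_neg z)

/-- If the Laplace transform of `μ` at large `u` is an affine function of a resolvent
evaluated at `u ^ α`, the first moment of the tilted measures decays polynomially. -/
theorem exists_norm_integral_mul_exp_le (hμ : ∀ᵐ x ∂μ, 0 ≤ x) {α : ℝ} (hα : 0 < α) (a : A)
    (ℓ : A →L[ℂ] ℂ) (c : ℂ)
    (h : ∀ᶠ u : ℝ in atTop,
      ((∫ x, Real.exp (-(u * x)) ∂μ : ℝ) : ℂ) = c + ℓ (resolvent a ((u ^ α : ℝ) : ℂ))) :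
    ∃ M K : ℝ, 0 < M ∧ 0 ≤ K ∧ ∀ z : ℂ, M < z.re →
      ‖∫ x, (x : ℂ) * Complex.exp (-z * x) ∂μ‖ ≤ K * ‖z‖ ^ (-(1 + α)) := by
  obtain ⟨M₀, C, hC0, hMC⟩ := exists_resolvent_cpow_bound a hα
  obtain ⟨U, hU⟩ := eventually_atTop.1 h
  set M := max 1 (max M₀ U) with hM
  have hM1 : 1 ≤ M := le_max_left _ _
  have hMM : M₀ ≤ M := (le_max_left _ _).trans (le_max_right _ _)
  have hMU : U ≤ M := (le_max_right _ _).trans (le_max_right _ _)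
  set D : Set ℂ := {z | M < z.re} with hD
  have hDo : IsOpen D := isOpen_lt continuous_const Complex.continuous_re
  have hDc : Convex ℝ D := convex_halfSpace_re_gt M
  have hpos : ∀ z ∈ D, 0 < z.re := fun z hz => by
    have : M < z.re := hz
    linarith
  have hnorm : ∀ z ∈ D, M₀ ≤ ‖z‖ := fun z hz =>
    hMM.trans ((le_of_lt hz).trans (Complex.re_le_norm z))
  have hd1 : ∀ z ∈ D, HasDerivAt (fun z : ℂ => complexMGF id μ (-z)) _ z := fun z hz =>
    hasDerivAt_laplace hμ (hpos z hz)
  have hd2 : ∀ z ∈ D, HasDerivAt (fun z : ℂ => c + ℓ (resolvent a (z ^ (α : ℂ)))) _ z :=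
    fun z hz => hasDerivAt_resolvent_cpow a ℓ c α (hpos z hz) (hMC z (hnorm z hz)).1
  have hz₀ : ((M + 1 : ℝ) : ℂ) ∈ D := by simp [hD]
  have hreal : ∀ u : ℝ, M ≤ u →
      complexMGF id μ (-(u : ℂ)) = c + ℓ (resolvent a ((u : ℂ) ^ (α : ℂ))) := by
    intro u hu
    rw [← Complex.ofReal_neg, complexMGF_ofReal, ← Complex.ofReal_cpow (by linarith),
      ← hU u (hMU.trans hu)]
    simp [mgf]
  -- Identity theorem on the half-plane: both sides agree at real points accumulating at `M + 1`.
  have hEq : EqOn (fun z : ℂ => complexMGF id μ (-z))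
      (fun z : ℂ => c + ℓ (resolvent a (z ^ (α : ℂ)))) D := by
    refine AnalyticOnNhd.eqOn_of_preconnected_of_frequently_eq
      (DifferentiableOn.analyticOnNhd
        (fun z hz => (hd1 z hz).differentiableAt.differentiableWithinAt) hDo)
      (DifferentiableOn.analyticOnNhd
        (fun z hz => (hd2 z hz).differentiableAt.differentiableWithinAt) hDo)
      hDc.isPreconnected hz₀ ?_
    have hev : ∃ᶠ u : ℝ in nhdsWithin (M + 1) {M + 1}ᶜ,
        complexMGF id μ (-(u : ℂ)) = c + ℓ (resolvent a ((u : ℂ) ^ (α : ℂ))) := by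
      refine Eventually.frequently ?_
      filter_upwards [nhdsWithin_le_nhds (Ioi_mem_nhds (lt_add_one M))] with u hu
      exact hreal u (le_of_lt hu)
    refine Tendsto.frequently ?_ hev
    refine tendsto_nhdsWithin_iff.2
      ⟨(Complex.continuous_ofReal.tendsto _).mono_left nhdsWithin_le_nhds, ?_⟩
    filter_upwards [self_mem_nhdsWithin] with u hu
    simpa only [mem_compl_iff, mem_singleton_iff, Complex.ofReal_inj] using hu
  refine ⟨M, ‖ℓ‖ * C ^ 2 * α, by linarith, by positivity, fun z hz => ?_⟩
  have hz0 : 0 < ‖z‖ := (hpos z hz).trans_le (Complex.re_le_norm z)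
  have hder := ((hd1 z hz).congr_of_eventuallyEq
    (hEq.symm.eventuallyEq_of_mem (hDo.mem_nhds hz))).unique (hd2 z hz)
  rw [← norm_neg, hder, norm_mul, norm_mul]
  have hb := (hMC z (hnorm z hz)).2
  have h1 : ‖ℓ (-(resolvent a (z ^ (α : ℂ))) ^ 2)‖ ≤ ‖ℓ‖ * (C * ‖z‖ ^ (-α)) ^ 2 := by
    refine (ℓ.le_opNorm _).trans ?_
    gcongr
    rw [norm_neg]
    refine (norm_pow_le' _ two_pos).trans ?_
    gcongr
  have h2 : ‖z ^ ((α : ℂ) - 1)‖ = ‖z‖ ^ (α - 1) := by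
    rw [← Complex.norm_cpow_real]
    simp
  have h3 : ‖(α : ℂ)‖ = α := by simp [abs_of_pos hα]
  rw [h2, h3]
  -- The squared resolvent contributes -2α and the inner derivative α - 1, in total -(1 + α).
  calc _ ≤ ‖ℓ‖ * (C * ‖z‖ ^ (-α)) ^ 2 * (α * ‖z‖ ^ (α - 1)) := by gcongr
    _ = ‖ℓ‖ * C ^ 2 * α * (‖z‖ ^ (-α) * ‖z‖ ^ (-α) * ‖z‖ ^ (α - 1)) := by ring
    _ = ‖ℓ‖ * C ^ 2 * α * ‖z‖ ^ (-(1 + α)) := by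
      rw [← Real.rpow_add hz0, ← Real.rpow_add hz0]
      ring_nf

/-- A measure on `[0, ∞)` whose Laplace transform at large `u` is an affine function of a
resolvent evaluated at `u ^ α` has no singular part away from the origin. -/
theorem restrict_Ioi_absolutelyContinuous_of_laplace (hμ : ∀ᵐ x ∂μ, 0 ≤ x) {α : ℝ} (hα : 0 < α)
    (a : A) (ℓ : A →L[ℂ] ℂ) (c : ℂ)
    (h : ∀ᶠ u : ℝ in atTop,
      ((∫ x, Real.exp (-(u * x)) ∂μ : ℝ) : ℂ) = c + ℓ (resolvent a ((u ^ α : ℝ) : ℂ))) :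
    μ.restrict (Ioi 0) ≪ volume := by
  obtain ⟨M, K, hM, hK, hMK⟩ := exists_norm_integral_mul_exp_le hμ hα a ℓ c h
  -- The factor `x` differentiates the transform and kills the atom at zero; the exponential moves
  -- the evaluation to the line Re z = M + 1, inside the region of decay.
  set ρ : ℝ → ℝ := fun x => x * Real.exp (-((M + 1) * x)) with hρ
  have hρm : Measurable ρ := by fun_prop
  have hρ0 : ∀ᵐ x ∂μ, 0 ≤ ρ x := by
    filter_upwards [hμ] with x hx
    positivity
  have hρi : Integrable ρ μ := by
    refine Integrable.of_bound hρm.aestronglyMeasurable 1 ?_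
    filter_upwards [hμ] with x hx
    rw [Real.norm_eq_abs, abs_of_nonneg (by positivity), hρ]
    simp only [Real.exp_neg]
    rw [mul_inv_le_iff₀ (Real.exp_pos _), one_mul]
    have := Real.add_one_le_exp ((M + 1) * x)
    nlinarith [mul_nonneg hM.le hx]
  set κ := μ.withDensity fun x => ENNReal.ofReal (ρ x) with hκ
  have : IsFiniteMeasure κ := isFiniteMeasure_withDensity_ofReal hρi.2
  have hchar : ∀ t : ℝ, charFun κ t =
      ∫ x, (x : ℂ) * Complex.exp (-((M + 1 : ℝ) - t * Complex.I) * x) ∂μ := by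
    intro t
    rw [charFun_apply_real, hκ, integral_withDensity_eq_integral_toReal_smul
      hρm.ennreal_ofReal (.of_forall fun _ => ENNReal.ofReal_lt_top)]
    refine integral_congr_ae ?_
    filter_upwards [hρ0] with x hx
    rw [ENNReal.toReal_ofReal hx, Complex.real_smul, hρ]
    push_cast
    rw [mul_assoc, ← Complex.exp_add]
    ring_nf
  have hint : Integrable (charFun κ) := by
    have hdom : Integrable fun t : ℝ => K * (2 ^ (1 + α) * (1 + ‖t‖) ^ (-(1 + α))) :=
      ((integrable_one_add_norm (by simpa using hα)).const_mul _).const_mul _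
    refine hdom.mono' measurable_charFun.aestronglyMeasurable (.of_forall fun t => ?_)
    rw [hchar t]
    set z : ℂ := (M + 1 : ℝ) - t * Complex.I with hz
    have hre : z.re = M + 1 := by simp [hz]
    have him : z.im = -t := by simp [hz]
    refine (hMK z (by linarith)).trans ?_
    gcongr
    have h1 := (le_abs_self _).trans (Complex.abs_re_le_norm z)
    have h2 := Complex.abs_im_le_norm z
    rw [hre] at h1
    rw [him, abs_neg] at h2
    have h3 : (1 + ‖t‖) / 2 ≤ ‖z‖ := by
      rw [Real.norm_eq_abs]
      linarith
    refine (Real.rpow_le_rpow_of_nonpos (by positivity) h3 (by linarith)).trans_eq ?_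
    rw [Real.div_rpow (by positivity) (by positivity), Real.rpow_neg (show (0 : ℝ) ≤ 2 by simp),
      div_inv_eq_mul, mul_comm]
  have hac := absolutelyContinuous_of_integrable_charFun κ hint
  -- Since `ρ > 0` on (0, ∞), a `κ`-null set meets (0, ∞) in a `μ`-null set.
  refine Measure.AbsolutelyContinuous.mk fun s hs hs0 => ?_
  have h0 := hac hs0
  rw [hκ, withDensity_apply _ hs, lintegral_eq_zero_iff hρm.ennreal_ofReal] at h0
  rw [Measure.restrict_apply hs]
  rw [Filter.EventuallyEq, ae_restrict_iff' hs] at h0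
  refine measure_mono_null (fun x hx => ?_) h0
  have hx0 : 0 < x := hx.2
  have : 0 < ρ x := by positivity
  simpa [hx.1] using this

end LaplaceDensity

/-! ### Identification of the atom and of the absolutely continuous part -/

section Assembly

open Filter Set Matrix

attribute [local instance] Matrix.linftyOpNormedRing Matrix.linftyOpNormedAlgebra

/-- A real bilinear expression in the resolvent of a real matrix, as a continuous linear
functional of the complex resolvent. -/
theorem exists_functional_resolvent {ι : Type*} [Fintype ι] [DecidableEq ι] (S : Matrix ι ι ℝ)
    (β s : ι → ℝ) :
    ∃ ℓ : Matrix ι ι ℂ →L[ℂ] ℂ, ∀ q : ℝ, IsUnit (q • (1 : Matrix ι ι ℝ) - S) →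
      ((β ⬝ᵥ ((q • (1 : Matrix ι ι ℝ) - S)⁻¹ *ᵥ s) : ℝ) : ℂ) =
        ℓ (resolvent (S.map Complex.ofReal) (q : ℂ)) := by
  let ℓ₀ : Matrix ι ι ℂ →ₗ[ℂ] ℂ :=
    { toFun := fun B => (fun i => (β i : ℂ)) ⬝ᵥ (B *ᵥ fun i => (s i : ℂ))
      map_add' := fun B B' => by simp [add_mulVec]
      map_smul' := fun c B => by simp [smul_mulVec] }
  refine ⟨LinearMap.toContinuousLinearMap ℓ₀, fun q hq => ?_⟩
  have hdet := (isUnit_iff_isUnit_det _).1 hq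
  have hmap : algebraMap ℂ (Matrix ι ι ℂ) q - S.map Complex.ofReal =
      Complex.ofRealHom.mapMatrix (q • (1 : Matrix ι ι ℝ) - S) := by
    ext i j
    by_cases h : i = j
    · simp [h, Matrix.algebraMap_matrix_apply]
    · simp [h, Matrix.algebraMap_matrix_apply]
  have hres : resolvent (S.map Complex.ofReal) (q : ℂ) =
      Complex.ofRealHom.mapMatrix (q • (1 : Matrix ι ι ℝ) - S)⁻¹ := by
    rw [resolvent, hmap, ← Matrix.nonsing_inv_eq_ringInverse]
    refine inv_eq_left_inv ?_
    rw [← map_mul, nonsing_inv_mul _ hdet, map_one]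
  rw [LinearMap.coe_toContinuousLinearMap', hres]
  simp [ℓ₀, dotProduct, mulVec]

/-- Dominated convergence: on [0, ∞), e^(-ux) tends to the indicator of {0}. -/
theorem tendsto_laplace_atTop (μ : Measure ℝ) [IsFiniteMeasure μ] (hμ : ∀ᵐ x ∂μ, 0 ≤ x) :
    Tendsto (fun u : ℝ => ∫ x, Real.exp (-(u * x)) ∂μ) atTop (nhds (μ.real {0})) := by
  have h0 : μ.real {0} = ∫ x, ({0} : Set ℝ).indicator 1 x ∂μ := by
    rw [integral_indicator_one (measurableSet_singleton 0)]
  rw [h0]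
  refine tendsto_integral_filter_of_dominated_convergence (fun _ => 1)
    (.of_forall fun u => by fun_prop) ?_ (integrable_const 1) ?_
  · filter_upwards [eventually_ge_atTop 0] with u hu
    filter_upwards [hμ] with x hx
    rw [Real.norm_eq_abs, Real.abs_exp, Real.exp_le_one_iff]
    have := mul_nonneg hu hx
    linarith
  · filter_upwards [hμ] with x hx
    rcases hx.eq_or_lt with rfl | hx
    · simp
    · rw [indicator_of_notMem (by simpa using hx.ne')]
      exact Real.tendsto_exp_neg_atTop_nhds_zero.comp (tendsto_id.atTop_mul_const hx)

theorem eq_restrict_Ioi_add_dirac (μ : Measure ℝ) (hμ : ∀ᵐ x ∂μ, 0 ≤ x) :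
    μ = μ.restrict (Ioi 0) + μ {0} • Measure.dirac 0 := by
  rw [← Measure.restrict_singleton, ← Measure.restrict_union (by simp) (measurableSet_singleton 0)]
  refine (Measure.restrict_eq_self_of_ae_mem ?_).symm
  filter_upwards [hμ] with x hx
  simpa using hx

/-- A finite measure on `[0, ∞)` whose Laplace transform is that of a defective fractional
phase-type distribution plus an atom at zero decomposes accordingly. -/
theorem isFracPH_restrict_Ioi {ι : Type*} [Fintype ι] [DecidableEq ι] {μ : Measure ℝ}
    [IsFiniteMeasure μ] (hμ : ∀ᵐ x ∂μ, 0 ≤ x) {α : ℝ} (hα : 0 < α) (hα1 : α ≤ 1)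
    {β : ι → ℝ} {S : Matrix ι ι ℝ} (hβ : ∀ i, 0 ≤ β i) (hβ1 : ∑ i, β i ≤ 1)
    (hS : IsSubIntensity S)
    (h : ∀ u : ℝ, 0 ≤ u → ∫ x, Real.exp (-(u * x)) ∂μ =
      1 - ∑ i, β i + β ⬝ᵥ ((u ^ α • (1 : Matrix ι ι ℝ) - S)⁻¹ *ᵥ exitRates S)) :
    μ.restrict (Ioi 0) ≪ volume ∧ IsFracPH (μ.restrict (Ioi 0)) α β S ∧
      μ = μ.restrict (Ioi 0) + ENNReal.ofReal (1 - ∑ i, β i) • Measure.dirac 0 := by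
  obtain ⟨ℓ, hℓ⟩ := exists_functional_resolvent S β (exitRates S)
  have hℓ' : ∀ u : ℝ, 0 ≤ u → β ⬝ᵥ ((u ^ α • (1 : Matrix ι ι ℝ) - S)⁻¹ *ᵥ exitRates S) =
      (ℓ (resolvent (S.map Complex.ofReal) ((u ^ α : ℝ) : ℂ)) : ℂ) := fun u hu =>
    hℓ _ (hS.isUnit_smul_one_sub (Real.rpow_nonneg hu α))
  have hev : ∀ᶠ u : ℝ in atTop, ((∫ x, Real.exp (-(u * x)) ∂μ : ℝ) : ℂ) =
      ((1 - ∑ i, β i : ℝ) : ℂ) + ℓ (resolvent (S.map Complex.ofReal) ((u ^ α : ℝ) : ℂ)) := by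
    filter_upwards [eventually_ge_atTop 0] with u hu
    rw [h u hu, Complex.ofReal_add, hℓ' u hu]
  have hac := restrict_Ioi_absolutelyContinuous_of_laplace hμ hα _ ℓ _ hev
  -- Both sides of `hev` are compared at infinity, where the resolvent vanishes.
  have hatom : μ.real {0} = 1 - ∑ i, β i := by
    have h1 : Tendsto (fun u : ℝ => ((∫ x, Real.exp (-(u * x)) ∂μ : ℝ) : ℂ)) atTop
        (nhds (μ.real {0} : ℂ)) :=
      (Complex.continuous_ofReal.tendsto _).comp (tendsto_laplace_atTop μ hμ)
    have h2 : Tendsto (fun u : ℝ => ((u ^ α : ℝ) : ℂ)) atTop (Bornology.cobounded ℂ) := by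
      rw [← tendsto_norm_atTop_iff_cobounded]
      simp only [Complex.norm_real]
      exact tendsto_norm_atTop_atTop.comp (tendsto_rpow_atTop hα)
    have h3 := ((ℓ.continuous.tendsto 0).comp
      ((spectrum.resolvent_tendsto_cobounded (S.map Complex.ofReal)).comp h2)).const_add
        ((1 - ∑ i, β i : ℝ) : ℂ)
    rw [map_zero, add_zero] at h3
    have := tendsto_nhds_unique (h1.congr' hev) h3
    exact_mod_cast this
  have hatom' : μ {0} = ENNReal.ofReal (1 - ∑ i, β i) := by
    rw [← hatom, ofReal_measureReal]
  have hdec := eq_restrict_Ioi_add_dirac μ hμ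
  refine ⟨hac, ⟨hα, hα1, hβ, hβ1, hS, inferInstance, ae_restrict_of_ae hμ, fun u hu => ?_⟩,
    by rwa [hatom'] at hdec⟩
  have hint : Integrable (fun x => Real.exp (-(u * x))) μ := by
    refine Integrable.of_bound (by fun_prop) 1 ?_
    filter_upwards [hμ] with x hx
    rw [Real.norm_eq_abs, Real.abs_exp, Real.exp_le_one_iff]
    have := mul_nonneg hu hx
    linarith
  have hsplit : ∫ x, Real.exp (-(u * x)) ∂μ =
      ∫ x in Ioi 0, Real.exp (-(u * x)) ∂μ + μ.real {0} := by
    conv_lhs => rw [hdec]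
    rw [integral_add_measure hint.integrableOn, integral_smul_measure, integral_dirac]
    · simp [measureReal_def]
    · exact (integrable_dirac (by simp)).smul_measure (measure_ne_top _ _)
  have := h u hu
  linarith

end Assembly

theorem mainTheorem2 {Ω : Type*} [MeasurableSpace Ω] (P : Measure Ω) {p n : ℕ} (α : ℝ)
    (π : Fin p → ℝ) (T : Matrix (Fin p) (Fin p) ℝ) (R : Matrix (Fin p) (Fin n) ℝ)
    (Y : Ω → Fin n → ℝ) (hY : AEMeasurable Y P)
    (hlaw : IsMultiFracPH (P.map Y) α π T R)
    (w : Fin n → ℝ) (hw : ∀ k, 0 ≤ w k) (hw0 : w ≠ 0) :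
    IsUnit (blockZZ T (R *ᵥ w)) ∧
    ∃ ν : Measure ℝ,
      ν ≪ volume ∧
      IsFracPH ν α (projInit T (R *ᵥ w) π) (projMatrix T (R *ᵥ w) α) ∧
      P.map (fun ω => Y ω ⬝ᵥ w) =
        ν + ENNReal.ofReal (1 - ∑ i, projInit T (R *ᵥ w) π i) • Measure.dirac 0 := by
  have hr : ∀ i, 0 ≤ (R *ᵥ w) i := mulVec_nonneg_of_nonneg hlaw.reward_nonneg hw
  have hT := hlaw.subIntensity
  have hα := hlaw.alpha_pos
  refine ⟨(IsUnit.neg_iff _).1 (hT.toBlockZZ hr).isUnit_neg,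
    (P.map fun ω => Y ω ⬝ᵥ w).restrict (Set.Ioi 0), ?_⟩
  have hprob := hlaw.prob
  have hm : Measurable fun y : Fin n → ℝ => y ⬝ᵥ w := by
    unfold dotProduct
    fun_prop
  have hmap : P.map (fun ω => Y ω ⬝ᵥ w) = (P.map Y).map fun y => y ⬝ᵥ w :=
    (AEMeasurable.map_map_of_aemeasurable hm.aemeasurable hY).symm
  rw [hmap]
  have : IsProbabilityMeasure ((P.map Y).map fun y => y ⬝ᵥ w) :=
    Measure.isProbabilityMeasure_map hm.aemeasurable
  refine isFracPH_restrict_Ioi ?_ hα hlaw.alpha_le_one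
    (projInit_nonneg hT hr hlaw.init_nonneg)
    (sum_projInit_le_one hT hr hlaw.init_nonneg hlaw.init_sum) (hT.toProj hr α) fun u hu => ?_
  · rw [ae_map_iff hm.aemeasurable measurableSet_Ici]
    filter_upwards [hlaw.nonneg] with y hy
    exact dotProduct_nonneg_of_nonneg hy hw
  · rw [integral_map hm.aemeasurable (by fun_prop),
      ← dotProduct_resolvent_eq hT hr hlaw.init_sum hα (Real.rpow_nonneg hu α)]
    -- At θ = u w the diagonal factors as (R θ)^α = u^α (R w)^α.
    have := hlaw.laplace (u • w) fun k => mul_nonneg hu (hw k)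
    simpa only [dotProduct_smul, smul_eq_mul, Matrix.mulVec_smul,
      Pi.smul_apply, Real.mul_rpow hu (hr _)] using this
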